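/- Let $f=(f_j)_{j\ge 0}$ be a probability distribution on the non-negative integers with finite first and second factorial moments $q_1=\sum_j j f_j$ and $q_2=\sum_j j(j-1)f_j$, let $\nu$ be a random variable with distribution $f$, and let $Q>0$. Consider the randomly evolving tree that starts at time $0$ from a single living node (the root): every living node has an exponentially distributed lifetime with parameter $Q$, at the end of which it dies and is immediately connected to a number of new living nodes distributed as $\nu$; all lifetimes and all offspring numbers are mutually independent. Let $\mu(t)$ be the total number of (living and dead) nodes at time $t$. Write $\mathbf E$ for expectation and $\mathbf D$ for standard deviation. 1. (Subcritical case.) If $q_1<1$, then the limits $p_n=\lim_{t\to\infty}\mathcal P\{\mu(t)=n\}$, $n\ge 1$, exist and $\sum_{n\ge1}p_n=1$, so that there is a random variable $\tilde\mu$ (the stationary tree size), unique in distribution, with $\mathcal P\{\tilde\mu=n\}=\lim_{t\to\infty}\mathcal P\{\mu(t)=n\}$ for all $n\ge 1$. It has a finite second moment, and $$\mathbf E\{\tilde\mu\}=\frac{1}{1-q_1},\qquad \mathbf D\{\tilde\mu\}=\frac{\mathbf D\{\nu\}}{(1-q_1)^{3/2}}.$$ 2. (Supercritical case.) If $q_1>1$,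 then $$\lim_{t\to\infty}\mathbf E\{\mu(t)\,e^{-(q_1-1)Qt}\}=\frac{q_1}{q_1-1}.$$ 3. (Critical case.) If $q_1=1$, then $$\lim_{t\to\infty}\mathbf E\{\mu(t)/(Qt)\}=1.$$ -/

import Mathlib

open MeasureTheory ProbabilityTheory Filter Topology
open scoped ENNReal

namespace RandomTree

/-- The `j`-th factorial moment `q_j = ∑ n (n - 1) ⋯ (n - j + 1) f_n` of the offspring
distribution `f`. -/
noncomputable def factorialMoment (f : PMF ℕ) (j : ℕ) : ℝ≥0∞ :=
  ∑' n : ℕ, (n.descFactorial j : ℝ≥0∞) * f n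

/-- The mean offspring number `q₁` as a real number. -/
noncomputable def meanOffspring (f : PMF ℕ) : ℝ :=
  (factorialMoment f 1).toReal

/-- The standard deviation `D` of a distribution on the natural numbers. -/
noncomputable def stdDev (p : PMF ℕ) : ℝ :=
  √(variance (fun n : ℕ => (n : ℝ)) p.toMeasure)

/-- Potential nodes are labelled by finite sequences: the root is `[]` and `i :: u` is the
`i`-th child (counted from `0`) of `u`. With `ν u` the number of children that `u` produces
when it dies, `IsNode ν u` says that `u` is eventually produced. -/
def IsNode (ν : List ℕ → ℕ) : List ℕ → Prop
  | [] => True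
  | i :: u => IsNode ν u ∧ i < ν u

/-- The birth time of `u`: the sum of the lifetimes `τ` of its strict ancestors, since a node
is born at the instant at which its parent dies. -/
def birthTime (τ : List ℕ → ℝ) : List ℕ → ℝ
  | [] => 0
  | _ :: u => birthTime τ u + τ u

/-- The tree size `μ(t)`: the number of all nodes, living or dead, present at time `t`,
i.e. born no later than `t`. -/
noncomputable def treeSize (τ : List ℕ → ℝ) (ν : List ℕ → ℕ) (t : ℝ) : ℕ∞ :=
  {u : List ℕ | IsNode ν u ∧ birthTime τ u ≤ t}.encard

/-- `τ` and `ν` are the lifetimes and offspring numbers of a randomly evolving tree: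
all `τ u` and all `ν u` are mutually independent, every `τ u` is exponential with
rate `Q`, and every `ν u` has distribution `f`. -/
structure IsRandomTree {Ω : Type*} [MeasurableSpace Ω] (P : Measure Ω) (Q : ℝ) (f : PMF ℕ)
    (τ : List ℕ → Ω → ℝ) (ν : List ℕ → Ω → ℕ) : Prop where
  measurable_lifetime : ∀ u, Measurable (τ u)
  measurable_offspring : ∀ u, Measurable (ν u)
  map_lifetime : ∀ u, P.map (τ u) = expMeasure Q
  map_offspring : ∀ u, P.map (ν u) = f.toMeasure
  indep_lifetime : iIndepFun τ P
  indep_offspring : iIndepFun ν P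
  indep_lifetime_offspring : IndepFun (fun ω u => τ u ω) (fun ω u => ν u ω) P

/-- `p` is the distribution of the stationary tree size `μ̃`, the limit in distribution
of `μ(t)`: `P(μ(t) = n) → p n` as `t → ∞` for every positive integer `n`. -/
def IsStationaryLaw {Ω : Type*} [MeasurableSpace Ω] (P : Measure Ω)
    (τ : List ℕ → Ω → ℝ) (ν : List ℕ → Ω → ℕ) (p : PMF ℕ) : Prop :=
  ∀ n : ℕ, 0 < n →
    Tendsto (fun t : ℝ => P {ω | treeSize (fun u => τ u ω) (fun u => ν u ω) t = (n : ℕ∞)})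
      atTop (𝓝 (p n))

end RandomTree

/-! Whether a label is ever a node depends only on the offspring numbers, and its birth time only on
the lifetimes, so the tree splits into a Galton–Watson tree and independent clocks. Generation `k`
has expected size `q₁ ^ k`.

Subcritical case: the total progeny `N` has mean `1/(1 - q₁)`, hence is almost surely finite, and a
finite tree is complete after some finite time. So `μ(t) = N` eventually, and the law of `N` is the
stationary law (`exists_isStationaryLaw`). Splitting at the root, `N = 1 + ∑_{i<ν} N_i` with
independent copies `N_i`. With `m = E N` and `x = E N²` this gives `x = 1 + 2 q₁ m + q₁ x + q₂ m²`.
The equation determines `x` only once `x < ∞` is known. Cutting the tree at generation `k` turns it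
into a recursion with a bound uniform in `k`, and monotone convergence yields both finiteness and
the equation (`lintegral_totalSize_sq`).

Other cases: a node of generation `k` is born after `k` independent exponential lifetimes, that is,
at the `k`-th point of a Poisson process of rate `Q`. Hence `E μ(t) = ∑ k, q₁ ^ k P(K ≥ k) = E(1 +
q₁ + ⋯ + q₁ ^ K)` with `K` Poisson of parameter `Q t` (`lintegral_treeSize`). The exponential series
makes this explicit, and the limits can be read off. -/

namespace RandomTree

/-! ### Independence of functions of disjoint coordinates -/

section Independence

variable {Ω ι β γ γ' : Type*} [MeasurableSpace Ω] [MeasurableSpace β] [MeasurableSpace γ]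
  [MeasurableSpace γ'] {P : Measure Ω} {X : ι → Ω → β}

theorem indepFun_restrict_of_disjoint (hX : ∀ i, Measurable (X i)) (h : iIndepFun X P)
    {S T : Set ι} (hST : Disjoint S T) :
    IndepFun (fun ω (i : S) => X i ω) (fun ω (i : T) => X i ω) P := by
  have key : ∀ S : Set ι, MeasurableSpace.comap (fun ω (i : S) => X i ω) inferInstance =
      ⨆ i ∈ S, MeasurableSpace.comap (X i) inferInstance := by
    intro S
    rw [iSup_subtype', MeasurableSpace.pi, MeasurableSpace.comap_iSup]
    simp_rw [MeasurableSpace.comap_comp]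
    rfl
  rw [IndepFun_iff_Indep, key, key]
  exact indep_iSup_of_disjoint (fun i => (hX i).comap_le) h hST

theorem exists_measurable_factor_of_dependsOn [Nonempty β] {S : Set ι} {g : (ι → β) → γ}
    (hg : Measurable g) (hS : DependsOn g S) :
    ∃ g' : (S → β) → γ, Measurable g' ∧ ∀ x, g x = g' (fun i => x i) := by
  classical
  -- Coordinates outside `S` are frozen at an arbitrary value, which `g` does not see.
  let b : β := Classical.arbitrary β
  refine ⟨fun y => g (fun i => if h : i ∈ S then y ⟨i, h⟩ else b), ?_, fun x => ?_⟩
  · refine hg.comp (measurable_pi_lambda _ fun i => ?_)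
    by_cases h : i ∈ S
    · simpa [h] using measurable_pi_apply _
    · simp [h]
  · refine hS fun i hi => ?_
    simp [hi]

/-- Functions that depend on disjoint sets of coordinates of an independent family are
independent. -/
theorem indepFun_of_dependsOn [Nonempty β] (hX : ∀ i, Measurable (X i)) (h : iIndepFun X P)
    {S T : Set ι} (hST : Disjoint S T) {g : (ι → β) → γ} {g' : (ι → β) → γ'}
    (hg : Measurable g) (hg' : Measurable g') (hS : DependsOn g S) (hT : DependsOn g' T) :
    IndepFun (fun ω => g fun i => X i ω) (fun ω => g' fun i => X i ω) P := by
  obtain ⟨k, hk, hgk⟩ := exists_measurable_factor_of_dependsOn hg hS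
  obtain ⟨k', hk', hgk'⟩ := exists_measurable_factor_of_dependsOn hg' hT
  simp_rw [hgk, hgk']
  exact (indepFun_restrict_of_disjoint hX h hST).comp hk hk'

end Independence

theorem dependsOn_apply {ι β : Type*} (i : ι) : DependsOn (fun x : ι → β => x i) {i} :=
  fun _ _ h => h i rfl

/-! ### Expected cardinality of a random set -/

section Encard

variable {Ω α : Type*} [MeasurableSpace Ω] {s : Ω → Set α}

theorem encard_eq_tsum_indicator (s : Set α) :
    (s.encard : ℝ≥0∞) = ∑' a, s.indicator 1 a := by
  rw [← ENNReal.tsum_set_one, tsum_subtype s (fun _ => (1 : ℝ≥0∞))]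
  rfl

theorem measurable_encard [Countable α] (hs : ∀ a, MeasurableSet {ω | a ∈ s ω}) :
    Measurable fun ω => ((s ω).encard : ℝ≥0∞) := by
  simp_rw [encard_eq_tsum_indicator]
  exact Measurable.tsum fun a => measurable_const.indicator (hs a)

theorem lintegral_encard [Countable α] (P : Measure Ω) (hs : ∀ a, MeasurableSet {ω | a ∈ s ω}) :
    ∫⁻ ω, ((s ω).encard : ℝ≥0∞) ∂P = ∑' a, P {ω | a ∈ s ω} := by
  simp_rw [encard_eq_tsum_indicator]
  change ∫⁻ ω, ∑' a, {ω | a ∈ s ω}.indicator 1 ω ∂P = _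
  rw [lintegral_tsum fun a => (measurable_one.indicator (hs a)).aemeasurable]
  refine tsum_congr fun a => ?_
  exact lintegral_indicator_one (hs a)

end Encard

/-! ### Sums over labels, grouped by generation -/

section ListSums

theorem tsum_list_cons (h : List ℕ → ℝ≥0∞) :
    ∑' u, h u = h [] + ∑' i, ∑' u, h (i :: u) := by
  let e : Unit ⊕ (ℕ × List ℕ) ≃ List ℕ :=
    { toFun := Sum.elim (fun _ => []) fun p => p.1 :: p.2
      invFun := fun u => match u with
        | [] => Sum.inl ()
        | i :: u => Sum.inr (i, u)
      left_inv := by rintro (_ | ⟨i, u⟩) <;> rfl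
      right_inv := by rintro (_ | ⟨i, u⟩) <;> rfl }
  rw [← e.tsum_eq, Summable.tsum_sum (f := fun c => h (e c)) ENNReal.summable ENNReal.summable,
    ← ENNReal.tsum_prod]
  simp [e]

/-- The last entry of a label is the first step away from the root, so this splits a sum over the
subtrees of the root's children; `tsum_list_cons` instead splits at the youngest generation. -/
theorem tsum_list_concat (h : List ℕ → ℝ≥0∞) :
    ∑' u, h u = h [] + ∑' i, ∑' u, h (u ++ [i]) := by
  let e : List ℕ ≃ List ℕ := ⟨List.reverse, List.reverse, List.reverse_reverse, List.reverse_reverse⟩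
  rw [← e.tsum_eq, tsum_list_cons]
  congr 1
  refine tsum_congr fun i => ?_
  rw [← e.tsum_eq (fun u => h (u ++ [i]))]
  refine tsum_congr fun u => ?_
  simp [e]

/-- The probability that the node `u` exists, for the offspring distribution `f`. -/
noncomputable def nodeWeight (f : PMF ℕ) : List ℕ → ℝ≥0∞
  | [] => 1
  | i :: u => nodeWeight f u * f.toMeasure (Set.Ioi i)

/-- The tail-sum formula for the mean, by exchanging the two sums. -/
theorem tsum_toMeasure_Ioi (f : PMF ℕ) :
    ∑' i, f.toMeasure (Set.Ioi i) = factorialMoment f 1 := by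
  simp_rw [PMF.toMeasure_apply_eq_tsum]
  rw [ENNReal.tsum_comm]
  refine tsum_congr fun n => ?_
  rw [Nat.descFactorial_one, tsum_eq_sum (s := Finset.range n)]
  · rw [Finset.sum_congr rfl (g := fun _ => f n)]
    · simp
    · intro i hi
      simpa using fun h => absurd (Finset.mem_range.1 hi) (not_lt.2 h)
  · intro i hi
    simpa using fun h => absurd h (by simpa using hi)

theorem tsum_nodeWeight_length_eq (f : PMF ℕ) (k : ℕ) :
    ∑' u : List ℕ, (if u.length = k then nodeWeight f u else 0) = factorialMoment f 1 ^ k := by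
  induction k with
  | zero => rw [tsum_list_cons]; simp [nodeWeight]
  | succ k ih =>
    rw [tsum_list_cons]
    simp only [List.length_nil, List.length_cons, Nat.add_right_cancel_iff, nodeWeight]
    have : ∀ i, ∑' u : List ℕ, (if u.length = k then
        nodeWeight f u * f.toMeasure (Set.Ioi i) else 0) =
        factorialMoment f 1 ^ k * f.toMeasure (Set.Ioi i) := by
      intro i
      rw [← ih, ← ENNReal.tsum_mul_right]
      refine tsum_congr fun u => ?_
      split_ifs <;> simp
    simp_rw [this]
    rw [ENNReal.tsum_mul_left, tsum_toMeasure_Ioi, pow_succ]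
    simp

theorem tsum_nodeWeight_mul (f : PMF ℕ) (g : ℕ → ℝ≥0∞) :
    ∑' u : List ℕ, nodeWeight f u * g u.length = ∑' k, factorialMoment f 1 ^ k * g k := by
  simp_rw [← tsum_nodeWeight_length_eq, ← ENNReal.tsum_mul_right]
  rw [ENNReal.tsum_comm]
  refine tsum_congr fun u => ?_
  rw [tsum_eq_single u.length]
  · simp
  · intro k hk
    simp [hk.symm]

end ListSums

/-! ### The Galton–Watson tree and its mean size -/

theorem measurableSet_isNode (u : List ℕ) : MeasurableSet {x : List ℕ → ℕ | IsNode x u} := by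
  induction u with
  | nil => simp [IsNode]
  | cons i u ih =>
    exact ih.inter (measurable_pi_apply u (MeasurableSet.of_discrete (s := Set.Ioi i)))

/-- Only the offspring numbers of strict ancestors matter, and these have shorter labels. Hence
existence of `u` is independent of `ν u`. -/
theorem dependsOn_isNode (u : List ℕ) :
    DependsOn (fun x : List ℕ → ℕ => IsNode x u) {v | v.length < u.length} := by
  induction u with
  | nil => exact fun _ _ _ => rfl
  | cons i u ih =>
    intro x y h
    have h₁ : IsNode x u = IsNode y u := ih fun v hv => h v (by
      simp only [Set.mem_ofPred_eq, List.length_cons] at hv ⊢; omega)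
    have h₂ : x u = y u := h u (by simp)
    simp [IsNode, h₁, h₂]

theorem isNode_concat (x : List ℕ → ℕ) (i : ℕ) (u : List ℕ) :
    IsNode x (u ++ [i]) ↔ i < x [] ∧ IsNode (fun v => x (v ++ [i])) u := by
  induction u with
  | nil => simp [IsNode]
  | cons j u ih => simp only [List.cons_append, IsNode, ih]; tauto

/-- The number of nodes in the first `k` generations. -/
noncomputable def truncatedSize (k : ℕ) (x : List ℕ → ℕ) : ℝ≥0∞ :=
  ({u : List ℕ | u.length < k ∧ IsNode x u}.encard : ℝ≥0∞)

/-- The number of nodes that are ever produced. -/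
noncomputable def totalSize (x : List ℕ → ℕ) : ℕ∞ :=
  {u : List ℕ | IsNode x u}.encard

theorem measurableSet_mem_generation (k : ℕ) (u : List ℕ) :
    MeasurableSet {x : List ℕ → ℕ | u.length < k ∧ IsNode x u} :=
  (MeasurableSet.const _).inter (measurableSet_isNode u)

theorem measurable_truncatedSize (k : ℕ) : Measurable (truncatedSize k) :=
  measurable_encard (measurableSet_mem_generation k)

theorem measurable_totalSize : Measurable fun x => (totalSize x : ℝ≥0∞) :=
  measurable_encard measurableSet_isNode

theorem truncatedSize_zero (x : List ℕ → ℕ) : truncatedSize 0 x = 0 := by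
  simp [truncatedSize]

theorem truncatedSize_succ (k : ℕ) (x : List ℕ → ℕ) :
    truncatedSize (k + 1) x =
      1 + ∑' i, (Set.Ioi i).indicator 1 (x []) * truncatedSize k (fun v => x (v ++ [i])) := by
  classical
  simp only [truncatedSize, encard_eq_tsum_indicator]
  rw [tsum_list_concat]
  congr 1
  · exact Set.indicator_of_mem (by simp [IsNode]) _
  · refine tsum_congr fun i => ?_
    rw [← ENNReal.tsum_mul_left]
    refine tsum_congr fun u => ?_
    simp only [Set.indicator_apply, Set.mem_ofPred_eq, List.length_append, List.length_singleton,
      Nat.add_lt_add_iff_right, isNode_concat, Set.mem_Ioi, Pi.one_apply]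
    split_ifs <;> simp_all

theorem monotone_truncatedSize (x : List ℕ → ℕ) : Monotone fun k => truncatedSize k x := by
  intro k l hkl
  simp only [truncatedSize, ENat.toENNReal_le]
  exact Set.encard_le_encard fun u hu => ⟨hu.1.trans_le hkl, hu.2⟩

theorem iSup_truncatedSize (x : List ℕ → ℕ) :
    ⨆ k, truncatedSize k x = (totalSize x : ℝ≥0∞) := by
  classical
  have hind (u : List ℕ) : {u : List ℕ | IsNode x u}.indicator (1 : List ℕ → ℝ≥0∞) u =
      ⨆ k, {u : List ℕ | u.length < k ∧ IsNode x u}.indicator 1 u := by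
    apply le_antisymm
    · refine le_iSup_of_le (u.length + 1) ?_
      simp [Set.indicator_apply]
    · refine iSup_le fun k => Set.indicator_le_indicator_of_subset (fun v hv => hv.2) (by simp) u
  simp only [truncatedSize, totalSize, encard_eq_tsum_indicator, hind, ENNReal.tsum_eq_iSup_sum]
  rw [iSup_comm]
  refine iSup_congr fun s => ?_
  rw [ENNReal.finsetSum_iSup_of_monotone]
  intro u k l hkl
  refine Set.indicator_le_indicator_of_subset (fun v (hv : _ ∧ _) => ?_) (by simp) u
  exact ⟨hv.1.trans_le hkl, hv.2⟩

/-- `ν` is a family of independent offspring numbers with common distribution `f`. -/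
structure IsOffspringFamily {Ω : Type*} [MeasurableSpace Ω] (P : Measure Ω) (f : PMF ℕ)
    (ν : List ℕ → Ω → ℕ) : Prop where
  measurable : ∀ u, Measurable (ν u)
  map : ∀ u, P.map (ν u) = f.toMeasure
  indep : iIndepFun ν P

namespace IsOffspringFamily

variable {Ω : Type*} [MeasurableSpace Ω] {P : Measure Ω} {f : PMF ℕ} {ν : List ℕ → Ω → ℕ}

/-- The subtree of a child of the root is a copy of the whole tree; this drives the induction on
generations. -/
theorem shift (h : IsOffspringFamily P f ν) (i : ℕ) :
    IsOffspringFamily P f fun u => ν (u ++ [i]) where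
  measurable u := h.measurable _
  map u := h.map _
  indep := h.indep.precomp (g := fun u => u ++ [i]) fun u v huv => by simpa using huv

theorem measure_lt (h : IsOffspringFamily P f ν) (i : ℕ) (u : List ℕ) :
    P {ω | i < ν u ω} = f.toMeasure (Set.Ioi i) := by
  rw [← h.map u, Measure.map_apply (h.measurable u) (MeasurableSet.of_discrete)]
  rfl

theorem measurable_family (h : IsOffspringFamily P f ν) : Measurable fun ω u => ν u ω :=
  measurable_pi_lambda _ h.measurable

theorem measure_isNode (h : IsOffspringFamily P f ν) [IsProbabilityMeasure P] (u : List ℕ) :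
    P {ω | IsNode (fun v => ν v ω) u} = nodeWeight f u := by
  induction u with
  | nil => simp [IsNode, nodeWeight]
  | cons i u ih =>
    have hind : IndepFun (fun ω => IsNode (fun v => ν v ω) u) (fun ω => ν u ω) P :=
      indepFun_of_dependsOn h.measurable h.indep (S := {v | v.length < u.length}) (T := {u})
        (by simp) (g := fun x => IsNode x u) (g' := fun x => x u)
        (measurableSet_setOfPred.1 (measurableSet_isNode u))
        (measurable_pi_apply u) (dependsOn_isNode u) (dependsOn_apply u)
    -- The event is treated as a `Prop`-valued random variable, hence the preimage of `{True}`.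
    have := hind.measure_inter_preimage_eq_mul {True} (Set.Ioi i)
      (MeasurableSet.of_discrete) (MeasurableSet.of_discrete)
    rw [nodeWeight, ← ih, ← h.measure_lt i u]
    convert this using 2
    · ext ω; simp [IsNode]
    · simp only [Set.preimage, Set.mem_singleton_iff, eq_iff_iff, iff_true]
    · rfl

theorem lintegral_truncatedSize (h : IsOffspringFamily P f ν) [IsProbabilityMeasure P] (k : ℕ) :
    ∫⁻ ω, truncatedSize k (fun v => ν v ω) ∂P =
      ∑ j ∈ Finset.range k, factorialMoment f 1 ^ j := by
  simp only [truncatedSize]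
  rw [lintegral_encard P (s := fun ω => {u : List ℕ | u.length < k ∧ IsNode (fun v => ν v ω) u})
    fun u => h.measurable_family (measurableSet_mem_generation k u)]
  have : ∀ u : List ℕ, P {ω | u.length < k ∧ IsNode (fun v => ν v ω) u} =
      nodeWeight f u * if u.length < k then 1 else 0 := by
    intro u
    split_ifs with hu <;> simp [hu, h.measure_isNode]
  simp only [Set.mem_ofPred_eq, this]
  rw [tsum_nodeWeight_mul f fun n => if n < k then 1 else 0,
    tsum_eq_sum (s := Finset.range k) (by simp +contextual)]
  exact Finset.sum_congr rfl fun j hj => by simp [Finset.mem_range.1 hj]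

/-- A geometric series in `ℝ≥0∞`; truncated subtraction makes the formula give `∞` when the mean is
at least one. -/
theorem lintegral_totalSize (h : IsOffspringFamily P f ν) [IsProbabilityMeasure P] :
    ∫⁻ ω, (totalSize (fun v => ν v ω) : ℝ≥0∞) ∂P = (1 - factorialMoment f 1)⁻¹ := by
  simp only [totalSize]
  rw [lintegral_encard P (s := fun ω => {u : List ℕ | IsNode (fun v => ν v ω) u})
    fun u => h.measurable_family (measurableSet_isNode u)]
  simp only [Set.mem_ofPred_eq, h.measure_isNode]
  have := tsum_nodeWeight_mul f fun _ => 1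
  simp only [mul_one] at this
  rw [this, ENNReal.tsum_geometric]

end IsOffspringFamily

/-! ### Second moment of the truncated tree -/

theorem sum_range_sum_range_ite (n : ℕ) (a b : ℝ≥0∞) :
    ∑ i ∈ Finset.range n, ∑ j ∈ Finset.range n, (if i = j then a else b) =
      (n.descFactorial 1 : ℝ≥0∞) * a + (n.descFactorial 2 : ℝ≥0∞) * b := by
  have hrow : ∀ i ∈ Finset.range n, ∑ j ∈ Finset.range n, (if i = j then a else b) =
      a + ((n - 1 : ℕ) : ℝ≥0∞) * b := by
    intro i hi
    rw [← Finset.add_sum_erase _ _ hi, if_pos rfl,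
      Finset.sum_congr rfl (g := fun _ => b) fun j hj => if_neg (Finset.ne_of_mem_erase hj).symm]
    simp [Finset.card_erase_of_mem hi]
  rw [Finset.sum_congr rfl hrow]
  simp only [Finset.sum_const, Finset.card_range, nsmul_eq_mul, Nat.descFactorial_succ,
    Nat.descFactorial_zero, Nat.sub_zero, mul_one, Nat.cast_mul]
  ring

theorem tsum_tsum_indicator_mul_ite (n : ℕ) (a b : ℝ≥0∞) :
    ∑' i, ∑' j, (Set.Ioi i).indicator 1 n * (Set.Ioi j).indicator 1 n * (if i = j then a else b) =
      (n.descFactorial 1 : ℝ≥0∞) * a + (n.descFactorial 2 : ℝ≥0∞) * b := by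
  rw [← sum_range_sum_range_ite, tsum_eq_sum (s := Finset.range n)]
  · refine Finset.sum_congr rfl fun i hi => ?_
    rw [tsum_eq_sum (s := Finset.range n)]
    · refine Finset.sum_congr rfl fun j hj => ?_
      simp [Finset.mem_range.1 hi, Finset.mem_range.1 hj]
    · intro j hj
      simp [Set.indicator_of_notMem (s := Set.Ioi j) (a := n) (by simpa using hj)]
  · intro i hi
    simp [Set.indicator_of_notMem (s := Set.Ioi i) (a := n) (by simpa using hi)]

theorem lintegral_toMeasure_nat (f : PMF ℕ) (g : ℕ → ℝ≥0∞) :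
    ∫⁻ n, g n ∂f.toMeasure = ∑' n, g n * f n := by
  rw [lintegral_countable']
  exact tsum_congr fun n => by rw [f.toMeasure_apply_singleton n (MeasurableSet.of_discrete)]

/-- Among ordered pairs of children, `ν` are diagonal and `ν (ν - 1)` are not. It is applied with
`a` the second moment of one subtree and `b` the product of the means of two. -/
theorem tsum_tsum_lintegral_indicator_mul (f : PMF ℕ) (a b : ℝ≥0∞) :
    ∑' i, ∑' j, (∫⁻ n, (Set.Ioi i).indicator 1 n * (Set.Ioi j).indicator 1 n ∂f.toMeasure) *
      (if i = j then a else b) = factorialMoment f 1 * a + factorialMoment f 2 * b := by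
  have : ∀ i j : ℕ, (∫⁻ n, (Set.Ioi i).indicator 1 n * (Set.Ioi j).indicator 1 n ∂f.toMeasure) *
      (if i = j then a else b) = ∫⁻ n, (Set.Ioi i).indicator 1 n * (Set.Ioi j).indicator 1 n *
      (if i = j then a else b) ∂f.toMeasure := fun i j =>
    (lintegral_mul_const _ (Measurable.of_discrete)).symm
  simp_rw [this]
  have hsum (F : ℕ → ℕ → ℝ≥0∞) :
      ∑' j, ∫⁻ n, F j n ∂f.toMeasure = ∫⁻ n, ∑' j, F j n ∂f.toMeasure :=
    (lintegral_tsum fun j => (Measurable.of_discrete).aemeasurable).symm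
  simp_rw [hsum]
  simp_rw [tsum_tsum_indicator_mul_ite]
  rw [lintegral_toMeasure_nat, factorialMoment, factorialMoment, ← ENNReal.tsum_mul_right,
    ← ENNReal.tsum_mul_right, ← ENNReal.tsum_add]
  exact tsum_congr fun n => by ring

/-- The mean number of nodes in the first `k` generations. -/
noncomputable def truncatedMean (f : PMF ℕ) (k : ℕ) : ℝ≥0∞ :=
  ∑ j ∈ Finset.range k, factorialMoment f 1 ^ j

/-- The second moment of the number of nodes in the first `k` generations. -/
noncomputable def truncatedSecondMoment (f : PMF ℕ) : ℕ → ℝ≥0∞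
  | 0 => 0
  | k + 1 => 1 + 2 * (factorialMoment f 1 * truncatedMean f k) +
      (factorialMoment f 1 * truncatedSecondMoment f k +
        factorialMoment f 2 * truncatedMean f k ^ 2)

namespace IsOffspringFamily

variable {Ω : Type*} [MeasurableSpace Ω] {P : Measure Ω} {f : PMF ℕ} {ν : List ℕ → Ω → ℕ}

theorem lintegral_root (h : IsOffspringFamily P f ν) (g : ℕ → ℝ≥0∞) :
    ∫⁻ ω, g (ν [] ω) ∂P = ∫⁻ n, g n ∂f.toMeasure := by
  rw [← h.map [], lintegral_map (Measurable.of_discrete) (h.measurable [])]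

/-- The size of the subtree of the `i`-th child of the root depends only on the offspring numbers
of the descendants of that child. -/
theorem dependsOn_truncatedSize_shift (k i : ℕ) :
    DependsOn (fun x : List ℕ → ℕ => truncatedSize k fun v => x (v ++ [i]))
      (Set.range fun v => v ++ [i]) := by
  intro x y hxy
  have : (fun v => x (v ++ [i])) = fun v => y (v ++ [i]) := by
    funext v
    exact hxy _ ⟨v, rfl⟩
  simp only [this]

theorem measurable_truncatedSize_shift (k i : ℕ) :
    Measurable fun x : List ℕ → ℕ => truncatedSize k fun v => x (v ++ [i]) :=
  (measurable_truncatedSize k).comp (measurable_pi_lambda _ fun _ => measurable_pi_apply _)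

theorem lintegral_root_mul_shift (h : IsOffspringFamily P f ν) (k i j : ℕ) (g : ℕ → ℝ≥0∞) :
    ∫⁻ ω, g (ν [] ω) * (truncatedSize k (fun v => ν (v ++ [i]) ω) *
        truncatedSize k (fun v => ν (v ++ [j]) ω)) ∂P =
      (∫⁻ n, g n ∂f.toMeasure) * ∫⁻ ω, truncatedSize k (fun v => ν (v ++ [i]) ω) *
        truncatedSize k (fun v => ν (v ++ [j]) ω) ∂P := by
  have hg' : Measurable fun x : List ℕ → ℕ => truncatedSize k (fun v => x (v ++ [i])) *
      truncatedSize k (fun v => x (v ++ [j])) :=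
    (measurable_truncatedSize_shift k i).mul (measurable_truncatedSize_shift k j)
  have hg : Measurable fun x : List ℕ → ℕ => g (x []) :=
    (Measurable.of_discrete (f := g)).comp (measurable_pi_apply _)
  have hind := indepFun_of_dependsOn h.measurable h.indep (S := {[]}) (T := {[]}ᶜ)
    disjoint_compl_right hg hg' (fun x y hxy => by simp [hxy [] rfl]) (fun x y hxy => by
      have h₁ := dependsOn_truncatedSize_shift k i (x := x) (y := y)
        (by rintro _ ⟨v, rfl⟩; exact hxy _ (by simp))
      have h₂ := dependsOn_truncatedSize_shift k j (x := x) (y := y)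
        (by rintro _ ⟨v, rfl⟩; exact hxy _ (by simp))
      simp only at h₁ h₂ ⊢
      rw [h₁, h₂])
  have := lintegral_mul_eq_lintegral_mul_lintegral_of_indepFun
    (hg.comp h.measurable_family) (hg'.comp h.measurable_family) hind
  rw [← h.lintegral_root g]
  exact this

theorem lintegral_shift_mul_shift (h : IsOffspringFamily P f ν) [IsProbabilityMeasure P]
    (k : ℕ) {i j : ℕ} (hij : i ≠ j) :
    ∫⁻ ω, truncatedSize k (fun v => ν (v ++ [i]) ω) *
        truncatedSize k (fun v => ν (v ++ [j]) ω) ∂P = truncatedMean f k ^ 2 := by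
  have hg := measurable_truncatedSize_shift k i
  have hg' := measurable_truncatedSize_shift k j
  have hind := indepFun_of_dependsOn h.measurable h.indep
    (S := Set.range fun v => v ++ [i]) (T := Set.range fun v => v ++ [j])
    (by
      rw [Set.disjoint_left]
      rintro _ ⟨v, rfl⟩ ⟨w, hw⟩
      simp only [List.append_singleton_inj] at hw
      exact hij hw.2.symm) hg hg'
    (dependsOn_truncatedSize_shift k i) (dependsOn_truncatedSize_shift k j)
  have := lintegral_mul_eq_lintegral_mul_lintegral_of_indepFun
    (hg.comp h.measurable_family) (hg'.comp h.measurable_family) hind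
  refine this.trans ?_
  rw [sq, truncatedMean, ← (h.shift i).lintegral_truncatedSize k]
  congr 1
  rw [(h.shift i).lintegral_truncatedSize k, ← (h.shift j).lintegral_truncatedSize k]
  rfl

theorem lintegral_truncatedSize_sq (h : IsOffspringFamily P f ν) [IsProbabilityMeasure P]
    (k : ℕ) :
    ∫⁻ ω, truncatedSize k (fun v => ν v ω) ^ 2 ∂P = truncatedSecondMoment f k := by
  induction k generalizing ν with
  | zero => simp [truncatedSize_zero, truncatedSecondMoment]
  | succ k ih =>
    let A : ℕ → Ω → ℝ≥0∞ := fun i ω => (Set.Ioi i).indicator 1 (ν [] ω)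
    let S : ℕ → Ω → ℝ≥0∞ := fun i ω => truncatedSize k fun v => ν (v ++ [i]) ω
    have hA : ∀ i, Measurable (A i) := fun i =>
      (Measurable.of_discrete (f := (Set.Ioi i).indicator (1 : ℕ → ℝ≥0∞))).comp (h.measurable _)
    have hS : ∀ i, Measurable (S i) := fun i =>
      (measurable_truncatedSize_shift k i).comp h.measurable_family
    have hAS : ∀ i, Measurable fun ω => A i ω * S i ω := fun i => (hA i).mul (hS i)
    have hAA : ∀ i j, Measurable fun ω => A j ω * S j ω * (A i ω * S i ω) :=
      fun i j => (hAS j).mul (hAS i)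
    have hR : Measurable fun ω => ∑' i, A i ω * S i ω := Measurable.tsum hAS
    have hRR : Measurable fun ω => (∑' i, A i ω * S i ω) * (∑' i, A i ω * S i ω) := hR.mul hR
    -- The known mean of the first `k + 1` generations, with the root's contribution `1` cancelled.
    have hfirst : ∫⁻ ω, ∑' i, A i ω * S i ω ∂P = factorialMoment f 1 * truncatedMean f k := by
      have h₁ := h.lintegral_truncatedSize (k + 1)
      simp_rw [truncatedSize_succ] at h₁
      rw [lintegral_add_left measurable_const, Finset.sum_range_succ', add_comm] at h₁
      simp only [lintegral_const, measure_univ, mul_one, pow_zero] at h₁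
      refine (ENNReal.add_left_inj ENNReal.one_ne_top).1 (h₁.trans ?_)
      rw [truncatedMean, Finset.mul_sum]
      simp only [pow_succ']
    have hsecond : ∫⁻ ω, (∑' i, A i ω * S i ω) * (∑' i, A i ω * S i ω) ∂P =
        factorialMoment f 1 * truncatedSecondMoment f k +
          factorialMoment f 2 * truncatedMean f k ^ 2 := by
      rw [← tsum_tsum_lintegral_indicator_mul]
      simp_rw [← ENNReal.tsum_mul_left, ← ENNReal.tsum_mul_right]
      rw [lintegral_tsum fun i => (Measurable.tsum fun j =>
        hAA i j).aemeasurable]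
      refine tsum_congr fun i => ?_
      rw [lintegral_tsum fun j => (hAA i j).aemeasurable]
      refine tsum_congr fun j => ?_
      have hcomm : ∀ ω, A j ω * S j ω * (A i ω * S i ω) =
          (Set.Ioi i).indicator 1 (ν [] ω) * (Set.Ioi j).indicator 1 (ν [] ω) *
            (truncatedSize k (fun v => ν (v ++ [i]) ω) *
              truncatedSize k (fun v => ν (v ++ [j]) ω)) := by
        intro ω
        simp only [A, S]
        ring
      simp_rw [hcomm]
      rw [h.lintegral_root_mul_shift k i j
        fun n => (Set.Ioi i).indicator 1 n * (Set.Ioi j).indicator 1 n]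
      congr 1
      split_ifs with hij
      · subst hij
        simp_rw [← sq]
        exact ih (h.shift i)
      · exact h.lintegral_shift_mul_shift k hij
    have hexp : ∀ ω, truncatedSize (k + 1) (fun v => ν v ω) ^ 2 =
        1 + 2 * (∑' i, A i ω * S i ω) + (∑' i, A i ω * S i ω) * (∑' i, A i ω * S i ω) := by
      intro ω
      rw [truncatedSize_succ]
      ring
    simp_rw [hexp]
    rw [lintegral_add_right _ hRR, lintegral_add_left measurable_const,
      lintegral_const_mul _ hR, hfirst, hsecond, truncatedSecondMoment]
    simp

end IsOffspringFamily

/-! ### Passage to the whole tree in the subcritical case -/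

theorem one_add_mul_inv_one_sub (q : ℝ≥0∞) :
    1 + q * (1 - q)⁻¹ = (1 - q)⁻¹ := by
  rw [← ENNReal.tsum_geometric, ← ENNReal.tsum_mul_left,
    tsum_eq_zero_add' (f := fun n => q ^ n) ENNReal.summable]
  simp [pow_succ']

theorem inv_one_sub_ne_top {q : ℝ≥0∞} (hq : q < 1) : (1 - q)⁻¹ ≠ ∞ :=
  ENNReal.inv_ne_top.2 (tsub_pos_of_lt hq).ne'

theorem truncatedMean_le (f : PMF ℕ) (k : ℕ) :
    truncatedMean f k ≤ (1 - factorialMoment f 1)⁻¹ := by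
  rw [← ENNReal.tsum_geometric]
  exact ENNReal.sum_le_tsum _

theorem tendsto_truncatedMean (f : PMF ℕ) :
    Tendsto (truncatedMean f) atTop (𝓝 (1 - factorialMoment f 1)⁻¹) := by
  rw [← ENNReal.tsum_geometric]
  exact ENNReal.tendsto_nat_tsum _

/-- A bound for the second moments of the truncated sizes, finite in the subcritical case. -/
theorem truncatedSecondMoment_le (f : PMF ℕ) (k : ℕ) :
    truncatedSecondMoment f k ≤
      (1 + 2 * (factorialMoment f 1 * (1 - factorialMoment f 1)⁻¹) +
        factorialMoment f 2 * (1 - factorialMoment f 1)⁻¹ ^ 2) * (1 - factorialMoment f 1)⁻¹ := by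
  set q := factorialMoment f 1
  set m := (1 - q)⁻¹
  induction k with
  | zero => simp [truncatedSecondMoment]
  | succ k ih =>
    -- With `C = 1 + 2qm + q₂m²`, the bound `C m` is a fixed point of `x ↦ C + q x`, because `1 + q
    -- m = m`.
    calc truncatedSecondMoment f (k + 1)
        ≤ 1 + 2 * (q * m) + (q * ((1 + 2 * (q * m) + factorialMoment f 2 * m ^ 2) * m) +
            factorialMoment f 2 * m ^ 2) := by
          rw [truncatedSecondMoment]
          gcongr <;> exact truncatedMean_le f k
      _ = (1 + 2 * (q * m) + factorialMoment f 2 * m ^ 2) * (1 + q * m) := by ring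
      _ = _ := by rw [one_add_mul_inv_one_sub]

namespace IsOffspringFamily

variable {Ω : Type*} [MeasurableSpace Ω] {P : Measure Ω} {f : PMF ℕ} {ν : List ℕ → Ω → ℕ}

theorem tendsto_truncatedSecondMoment (h : IsOffspringFamily P f ν) [IsProbabilityMeasure P] :
    Tendsto (truncatedSecondMoment f) atTop
      (𝓝 (∫⁻ ω, (totalSize (fun v => ν v ω) : ℝ≥0∞) ^ 2 ∂P)) := by
  have : truncatedSecondMoment f = fun k => ∫⁻ ω, truncatedSize k (fun v => ν v ω) ^ 2 ∂P :=
    funext fun k => (h.lintegral_truncatedSize_sq k).symm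
  rw [this]
  refine lintegral_tendsto_of_tendsto_of_monotone
    (fun k => (((measurable_truncatedSize k).comp h.measurable_family).pow_const 2).aemeasurable)
    (ae_of_all _ fun ω k l hkl => pow_le_pow_left' (monotone_truncatedSize _ hkl) 2)
    (ae_of_all _ fun ω => ?_)
  rw [← iSup_truncatedSize]
  exact ENNReal.Tendsto.pow (tendsto_atTop_iSup (monotone_truncatedSize _))

theorem lintegral_totalSize_sq_ne_top (h : IsOffspringFamily P f ν) [IsProbabilityMeasure P]
    (hq₁ : factorialMoment f 1 < 1) (hq₂ : factorialMoment f 2 ≠ ∞) :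
    ∫⁻ ω, (totalSize (fun v => ν v ω) : ℝ≥0∞) ^ 2 ∂P ≠ ∞ := by
  refine ne_top_of_le_ne_top ?_ (le_of_tendsto' h.tendsto_truncatedSecondMoment
    (truncatedSecondMoment_le f))
  have := inv_one_sub_ne_top hq₁
  have := hq₁.ne_top
  finiteness

theorem lintegral_totalSize_sq (h : IsOffspringFamily P f ν) [IsProbabilityMeasure P]
    (hq₁ : factorialMoment f 1 < 1) (hq₂ : factorialMoment f 2 ≠ ∞) :
    ∫⁻ ω, (totalSize (fun v => ν v ω) : ℝ≥0∞) ^ 2 ∂P =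
      1 + 2 * (factorialMoment f 1 * (1 - factorialMoment f 1)⁻¹) +
        (factorialMoment f 1 * ∫⁻ ω, (totalSize (fun v => ν v ω) : ℝ≥0∞) ^ 2 ∂P +
          factorialMoment f 2 * (1 - factorialMoment f 1)⁻¹ ^ 2) := by
  have hm := tendsto_truncatedMean f
  have hx := h.tendsto_truncatedSecondMoment
  refine tendsto_nhds_unique (hx.comp (tendsto_add_atTop_nat 1)) ?_
  simp only [Function.comp_def, truncatedSecondMoment]
  refine Tendsto.add (tendsto_const_nhds.add ?_) (Tendsto.add ?_ ?_)
  · exact ENNReal.Tendsto.const_mul (ENNReal.Tendsto.const_mul hm (Or.inr hq₁.ne_top))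
      (Or.inr (by simp))
  · exact ENNReal.Tendsto.const_mul hx (Or.inr hq₁.ne_top)
  · exact ENNReal.Tendsto.const_mul (ENNReal.Tendsto.pow hm) (Or.inr hq₂)

theorem ae_totalSize_ne_top (h : IsOffspringFamily P f ν) [IsProbabilityMeasure P]
    (hq₁ : factorialMoment f 1 < 1) : ∀ᵐ ω ∂P, totalSize (fun v => ν v ω) ≠ ⊤ := by
  have := ae_lt_top (measurable_totalSize.comp h.measurable_family)
    (by rw [Function.comp_def, h.lintegral_totalSize]; exact inv_one_sub_ne_top hq₁)
  filter_upwards [this] with ω hω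
  exact ENat.toENNReal_lt_top.1 hω |>.ne

end IsOffspringFamily

/-! ### Moments of laws on the natural numbers -/

section Moments

theorem memLp_two_of_lintegral_sq {p : PMF ℕ} (h : ∫⁻ n, (n : ℝ≥0∞) ^ 2 ∂p.toMeasure ≠ ∞) :
    MemLp (fun n : ℕ => (n : ℝ)) 2 p.toMeasure := by
  rw [memLp_two_iff_integrable_sq (Measurable.of_discrete.aestronglyMeasurable)]
  refine ⟨Measurable.of_discrete.aestronglyMeasurable, ?_⟩
  rw [hasFiniteIntegral_iff_ofReal (ae_of_all _ fun n => by positivity), lt_top_iff_ne_top]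
  convert h using 3 with n
  rw [ENNReal.ofReal_pow (by positivity), ENNReal.ofReal_natCast]

theorem integral_natCast (p : PMF ℕ) :
    ∫ n : ℕ, (n : ℝ) ∂p.toMeasure = (∫⁻ n, (n : ℝ≥0∞) ∂p.toMeasure).toReal := by
  rw [integral_eq_lintegral_of_nonneg_ae (ae_of_all _ fun n => by positivity)
    (Measurable.of_discrete.aestronglyMeasurable)]
  simp

theorem variance_natCast {p : PMF ℕ} (h : ∫⁻ n, (n : ℝ≥0∞) ^ 2 ∂p.toMeasure ≠ ∞) :
    variance (fun n : ℕ => (n : ℝ)) p.toMeasure = (∫⁻ n, (n : ℝ≥0∞) ^ 2 ∂p.toMeasure).toReal -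
      (∫⁻ n, (n : ℝ≥0∞) ∂p.toMeasure).toReal ^ 2 := by
  rw [variance_eq_sub (memLp_two_of_lintegral_sq h), integral_natCast]
  congr 1
  rw [integral_eq_lintegral_of_nonneg_ae (ae_of_all _ fun n => by simp)
    (Measurable.of_discrete.aestronglyMeasurable)]
  congr 2 with n
  simp [ENNReal.ofReal_pow]

theorem lintegral_natCast_eq_factorialMoment (f : PMF ℕ) :
    ∫⁻ n, (n : ℝ≥0∞) ∂f.toMeasure = factorialMoment f 1 := by
  rw [lintegral_toMeasure_nat, factorialMoment]
  simp

theorem lintegral_natCast_sq_eq_factorialMoment (f : PMF ℕ) :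
    ∫⁻ n, (n : ℝ≥0∞) ^ 2 ∂f.toMeasure = factorialMoment f 2 + factorialMoment f 1 := by
  rw [lintegral_toMeasure_nat, factorialMoment, factorialMoment, ← ENNReal.tsum_add]
  refine tsum_congr fun n => ?_
  rw [← add_mul]
  congr 1
  norm_cast
  cases n with
  | zero => simp
  | succ n => simp [Nat.descFactorial_succ]; ring

end Moments

/-! ### The stationary law -/

theorem measurable_birthTime (u : List ℕ) : Measurable fun x : List ℕ → ℝ => birthTime x u := by
  induction u with
  | nil => exact measurable_const
  | cons i u ih => exact ih.add (measurable_pi_apply u)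

/-- Finitely many birth times have an upper bound, after which every node is present. -/
theorem treeSize_eventuallyEq (x : List ℕ → ℝ) {y : List ℕ → ℕ} (hy : totalSize y ≠ ⊤) :
    ∀ᶠ t in atTop, treeSize x y t = totalSize y := by
  have hfin : {u : List ℕ | IsNode y u}.Finite := Set.encard_ne_top_iff.1 hy
  obtain ⟨B, hB⟩ := (hfin.image (birthTime x)).bddAbove
  filter_upwards [eventually_ge_atTop B] with t ht
  rw [treeSize, totalSize]
  congr 1
  ext u
  exact ⟨fun h => h.1, fun h => ⟨h, (hB ⟨u, h, rfl⟩).trans ht⟩⟩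

namespace IsRandomTree

variable {Ω : Type*} [MeasurableSpace Ω] {P : Measure Ω} {Q : ℝ} {f : PMF ℕ}
  {τ : List ℕ → Ω → ℝ} {ν : List ℕ → Ω → ℕ}

theorem isOffspringFamily (h : IsRandomTree P Q f τ ν) : IsOffspringFamily P f ν :=
  ⟨h.measurable_offspring, h.map_offspring, h.indep_offspring⟩

theorem measurableSet_present (h : IsRandomTree P Q f τ ν) (t : ℝ) (u : List ℕ) :
    MeasurableSet {ω | IsNode (fun v => ν v ω) u ∧ birthTime (fun v => τ v ω) u ≤ t} :=
  (h.isOffspringFamily.measurable_family (measurableSet_isNode u)).inter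
    (measurableSet_le ((measurable_birthTime u).comp
      (measurable_pi_lambda _ h.measurable_lifetime)) measurable_const)

theorem measurable_treeSize (h : IsRandomTree P Q f τ ν) (t : ℝ) :
    Measurable fun ω => (treeSize (fun u => τ u ω) (fun u => ν u ω) t : ℝ≥0∞) :=
  measurable_encard fun u => h.measurableSet_present t u

theorem measurableSet_treeSize_eq (h : IsRandomTree P Q f τ ν) (t : ℝ) (n : ℕ) :
    MeasurableSet {ω | treeSize (fun u => τ u ω) (fun u => ν u ω) t = (n : ℕ∞)} := by
  convert h.measurable_treeSize t (measurableSet_singleton (n : ℝ≥0∞)) using 1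
  ext ω
  simp only [Set.mem_ofPred_eq, Set.mem_preimage, Set.mem_singleton_iff]
  norm_cast

theorem measurable_totalSize_toNat (h : IsRandomTree P Q f τ ν) :
    Measurable fun ω => (totalSize fun v => ν v ω).toNat := by
  -- Both `toNat` and `toReal` send infinity to `0`, so the two maps agree there as well.
  have : Measurable fun a : ℝ≥0∞ => ⌊a.toReal⌋₊ := Nat.measurable_floor.comp ENNReal.measurable_toReal
  convert this.comp (measurable_totalSize.comp h.isOffspringFamily.measurable_family) using 2
    with ω
  simp only [Function.comp_apply]
  generalize totalSize (fun v => ν v ω) = N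
  cases N with
  | top => simp
  | coe n => simp

/-- The distribution of the number of nodes that are ever produced is a stationary law. -/
theorem exists_isStationaryLaw (h : IsRandomTree P Q f τ ν) [IsProbabilityMeasure P]
    (hq : factorialMoment f 1 < 1) :
    ∃ p : PMF ℕ, IsStationaryLaw P τ ν p ∧
      ∫⁻ n, (n : ℝ≥0∞) ∂p.toMeasure = ∫⁻ ω, (totalSize (fun v => ν v ω) : ℝ≥0∞) ∂P ∧
      ∫⁻ n, (n : ℝ≥0∞) ^ 2 ∂p.toMeasure =
        ∫⁻ ω, (totalSize (fun v => ν v ω) : ℝ≥0∞) ^ 2 ∂P := by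
  have hN := h.measurable_totalSize_toNat
  have hfin := h.isOffspringFamily.ae_totalSize_ne_top hq
  have : IsProbabilityMeasure (P.map fun ω => (totalSize fun v => ν v ω).toNat) :=
    Measure.isProbabilityMeasure_map hN.aemeasurable
  have happly (n : ℕ) : (P.map fun ω => (totalSize fun v => ν v ω).toNat).toPMF n =
      P {ω | (totalSize fun v => ν v ω).toNat = n} := by
    rw [Measure.toPMF_apply, Measure.map_apply hN (measurableSet_singleton n)]
    rfl
  refine ⟨(P.map fun ω => (totalSize fun v => ν v ω).toNat).toPMF, fun n _ => ?_, ?_, ?_⟩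
  · rw [happly]
    -- Almost surely the indicators are eventually constant in `t`.
    refine tendsto_measure_of_ae_tendsto_indicator_of_isFiniteMeasure atTop
      (hN (measurableSet_singleton n)) (fun t => h.measurableSet_treeSize_eq t n) ?_
    filter_upwards [hfin] with ω hω
    filter_upwards [treeSize_eventuallyEq (fun u => τ u ω) hω] with t ht
    obtain ⟨m, hm⟩ := ENat.ne_top_iff_exists.1 hω
    simp [ht, ← hm]
  all_goals
    rw [Measure.toPMF_toMeasure, lintegral_map (Measurable.of_discrete) hN]
    refine lintegral_congr_ae ?_
    filter_upwards [hfin] with ω hω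
    rw [← ENat.toENNReal_coe, ENat.natCast_toNat hω]

end IsRandomTree

/-- The limits fix all masses except the one at `0`, which total mass one then determines. -/
theorem eq_of_isStationaryLaw {Ω : Type*} [MeasurableSpace Ω] {P : Measure Ω}
    {τ : List ℕ → Ω → ℝ} {ν : List ℕ → Ω → ℕ} {p p' : PMF ℕ}
    (hp : IsStationaryLaw P τ ν p) (hp' : IsStationaryLaw P τ ν p') : p = p' := by
  have hpos (n : ℕ) : p (n + 1) = p' (n + 1) :=
    tendsto_nhds_unique (hp (n + 1) n.succ_pos) (hp' (n + 1) n.succ_pos)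
  have hzero : p 0 = p' 0 := by
    have h := p.tsum_coe.trans p'.tsum_coe.symm
    rw [tsum_eq_zero_add' ENNReal.summable, tsum_eq_zero_add' (f := p') ENNReal.summable] at h
    simp only [hpos] at h
    refine (ENNReal.add_left_inj (ne_top_of_le_ne_top ENNReal.one_ne_top ?_)).1 h
    rw [← p'.tsum_coe]
    exact ENNReal.tsum_comp_le_tsum_of_injective (add_left_injective 1) _
  ext n
  cases n with
  | zero => rw [hzero]
  | succ n => rw [hpos]

theorem variance_formula {q b x v : ℝ} (hq : q < 1)
    (hx : x = 1 + 2 * (q * (1 - q)⁻¹) + (q * x + b * (1 - q)⁻¹ ^ 2)) (hv : v = b + q - q ^ 2) :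
    x - (1 - q)⁻¹ ^ 2 = v / (1 - q) ^ 3 := by
  have h : 1 - q ≠ 0 := by linarith
  rw [eq_div_iff (pow_ne_zero 3 h)]
  field_simp at hx ⊢
  subst hv
  linear_combination hx

theorem sqrt_div_cube {v q : ℝ} (hq : 0 < q) (hv : 0 ≤ v) :
    √(v / q ^ 3) = √v / q ^ (3 / 2 : ℝ) := by
  rw [Real.sqrt_div hv, Real.sqrt_eq_rpow (q ^ 3), ← Real.rpow_natCast, ← Real.rpow_mul hq.le]
  norm_num

theorem IsRandomTree.subcritical {Ω : Type*} [MeasurableSpace Ω] {P : Measure Ω}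
    [IsProbabilityMeasure P] {Q : ℝ} {f : PMF ℕ} {τ : List ℕ → Ω → ℝ} {ν : List ℕ → Ω → ℕ}
    (h : IsRandomTree P Q f τ ν) (hq : factorialMoment f 1 < 1) (hq₂ : factorialMoment f 2 ≠ ∞) :
    (∃! p : PMF ℕ, IsStationaryLaw P τ ν p) ∧
      ∀ p : PMF ℕ, IsStationaryLaw P τ ν p →
        MemLp (fun n : ℕ => (n : ℝ)) 2 p.toMeasure ∧
        ∫ n : ℕ, (n : ℝ) ∂p.toMeasure = 1 / (1 - meanOffspring f) ∧
        stdDev p = stdDev f / (1 - meanOffspring f) ^ (3 / 2 : ℝ) := by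
  obtain ⟨p, hp, hmean, hsq⟩ := h.exists_isStationaryLaw hq
  refine ⟨⟨p, hp, fun p' hp' => eq_of_isStationaryLaw hp' hp⟩, fun p' hp' => ?_⟩
  obtain rfl := eq_of_isStationaryLaw hp' hp
  have hfam := h.isOffspringFamily
  have hx := hfam.lintegral_totalSize_sq hq hq₂
  have hxtop := hfam.lintegral_totalSize_sq_ne_top hq hq₂
  rw [hfam.lintegral_totalSize] at hmean
  rw [← hsq] at hx hxtop
  have hqtop : factorialMoment f 1 ≠ ∞ := hq.ne_top
  have hmtop := inv_one_sub_ne_top hq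
  have hmreal : ((1 - factorialMoment f 1)⁻¹).toReal = (1 - meanOffspring f)⁻¹ := by
    rw [ENNReal.toReal_inv, ENNReal.toReal_sub_of_le hq.le ENNReal.one_ne_top,
      ENNReal.toReal_one, meanOffspring]
  have hq' : meanOffspring f < 1 := by
    have := (ENNReal.toReal_lt_toReal hqtop ENNReal.one_ne_top).2 hq
    simpa [meanOffspring] using this
  refine ⟨memLp_two_of_lintegral_sq hxtop, ?_, ?_⟩
  · rw [integral_natCast, hmean, hmreal, one_div]
  · have hf : ∫⁻ n, (n : ℝ≥0∞) ^ 2 ∂f.toMeasure ≠ ∞ := by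
      rw [lintegral_natCast_sq_eq_factorialMoment]
      finiteness
    have hvar : variance (fun n : ℕ => (n : ℝ)) f.toMeasure =
        (factorialMoment f 2).toReal + meanOffspring f - meanOffspring f ^ 2 := by
      rw [variance_natCast hf, lintegral_natCast_sq_eq_factorialMoment,
        lintegral_natCast_eq_factorialMoment, ENNReal.toReal_add hq₂ hqtop, meanOffspring]
    have hxreal := congrArg ENNReal.toReal hx
    rw [ENNReal.toReal_add (by finiteness) (by finiteness),
      ENNReal.toReal_add (by finiteness) (by finiteness),
      ENNReal.toReal_add (by finiteness) (by finiteness)] at hxreal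
    simp only [ENNReal.toReal_mul, ENNReal.toReal_pow, hmreal, ENNReal.toReal_one,
      ENNReal.toReal_ofNat] at hxreal
    rw [stdDev, stdDev, variance_natCast hxtop, hmean, hmreal,
      variance_formula hq' hxreal hvar, sqrt_div_cube (by linarith) (variance_nonneg _ _)]

/-! ### Birth times and the Poisson process -/

/-- The probability that a Poisson variable with parameter `Q * t` equals `n`. -/
noncomputable def poissonWeight (Q t : ℝ) (n : ℕ) : ℝ≥0∞ :=
  ENNReal.ofReal (Real.exp (-(Q * t)) * ((Q * t) ^ n / n.factorial))

/-- The probability that the sum of `k` independent exponential variables with rate `Q` is at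
most `t`. -/
noncomputable def erlangCDF (Q : ℝ) (k : ℕ) (t : ℝ) : ℝ≥0∞ :=
  if 0 ≤ t then ∑' n, if k ≤ n then poissonWeight Q t n else 0 else 0

theorem hasSum_exp (x : ℝ) : HasSum (fun n : ℕ => x ^ n / n.factorial) (Real.exp x) := by
  rw [Real.exp_eq_exp_ℝ]
  exact NormedSpace.expSeries_div_hasSum_exp x

theorem tsum_poissonWeight {Q t : ℝ} (hQ : 0 < Q) (ht : 0 ≤ t) :
    ∑' n, poissonWeight Q t n = 1 := by
  have h := (hasSum_exp (Q * t)).mul_left (Real.exp (-(Q * t)))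
  rw [← Real.exp_add, neg_add_cancel, Real.exp_zero] at h
  simp only [poissonWeight]
  rw [← ENNReal.ofReal_tsum_of_nonneg (fun n => by positivity) h.summable, h.tsum_eq,
    ENNReal.ofReal_one]

theorem erlangCDF_zero {Q : ℝ} (hQ : 0 < Q) (t : ℝ) :
    erlangCDF Q 0 t = if 0 ≤ t then 1 else 0 := by
  rw [erlangCDF]
  split_ifs with ht
  · simp [tsum_poissonWeight hQ ht]
  · rfl

theorem setLIntegral_poissonWeight {Q t : ℝ} (hQ : 0 < Q) (ht : 0 ≤ t) (n : ℕ) :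
    ∫⁻ s in Set.Icc 0 t, ENNReal.ofReal (Q * Real.exp (-(Q * s))) * poissonWeight Q (t - s) n =
      poissonWeight Q t (n + 1) := by
  have hcongr : ∀ s ∈ Set.Icc 0 t,
      ENNReal.ofReal (Q * Real.exp (-(Q * s))) * poissonWeight Q (t - s) n =
        ENNReal.ofReal (Real.exp (-(Q * t)) * Q ^ (n + 1) / n.factorial * (t - s) ^ n) := by
    intro s _
    rw [poissonWeight, ← ENNReal.ofReal_mul (by positivity)]
    congr 1
    rw [show -(Q * t) = -(Q * s) + -(Q * (t - s)) by ring, Real.exp_add, mul_pow]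
    ring
  rw [setLIntegral_congr_fun measurableSet_Icc hcongr,
    ← ofReal_integral_eq_lintegral_ofReal]
  · rw [poissonWeight, integral_Icc_eq_integral_Ioc, ← intervalIntegral.integral_of_le ht,
      intervalIntegral.integral_const_mul,
      intervalIntegral.integral_comp_sub_left (fun s => s ^ n) t, integral_pow]
    congr 1
    rw [Nat.factorial_succ]
    push_cast
    field_simp
    simp
    ring
  · exact (by fun_prop : Continuous fun s : ℝ =>
      Real.exp (-(Q * t)) * Q ^ (n + 1) / n.factorial * (t - s) ^ n).integrableOn_Icc
  · filter_upwards [ae_restrict_mem measurableSet_Icc] with s hs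
    have := sub_nonneg.2 hs.2
    simp only [Pi.zero_apply]
    positivity

theorem measurable_poissonWeight (Q : ℝ) (n : ℕ) : Measurable fun t => poissonWeight Q t n := by
  unfold poissonWeight
  fun_prop

theorem measurable_erlangCDF (Q : ℝ) (k : ℕ) : Measurable (erlangCDF Q k) := by
  unfold erlangCDF
  refine Measurable.ite measurableSet_Ici (Measurable.tsum fun n => ?_) measurable_const
  split_ifs
  · exact measurable_poissonWeight Q n
  · exact measurable_const

/-- The recursion for the distribution of a sum of exponential variables. -/
theorem lintegral_erlangCDF_sub {Q : ℝ} (hQ : 0 < Q) (k : ℕ) (t : ℝ) :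
    ∫⁻ s, erlangCDF Q k (t - s) ∂expMeasure Q = erlangCDF Q (k + 1) t := by
  have hdens : expMeasure Q = volume.withDensity (exponentialPDF Q) := rfl
  have hpdf : Measurable (exponentialPDF Q) := (measurable_exponentialPDFReal Q).ennreal_ofReal
  rw [hdens, lintegral_withDensity_eq_lintegral_mul _ hpdf
    (g := fun s => erlangCDF Q k (t - s))
    ((measurable_erlangCDF Q k).comp (by fun_prop))]
  -- The density vanishes for `s < 0` and the distribution function for `s > t`, so only `[0, t]`
  -- contributes.
  have hpt : ∀ s, (exponentialPDF Q * fun s => erlangCDF Q k (t - s)) s =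
      (Set.Icc 0 t).indicator (fun s => ∑' n, if k ≤ n then
        ENNReal.ofReal (Q * Real.exp (-(Q * s))) * poissonWeight Q (t - s) n else 0) s := by
    intro s
    rw [Pi.mul_apply]
    by_cases hs : 0 ≤ s
    · by_cases hst : s ≤ t
      · rw [Set.indicator_of_mem (show s ∈ Set.Icc 0 t from ⟨hs, hst⟩),
          exponentialPDF_of_nonneg hs, erlangCDF, if_pos (sub_nonneg.2 hst),
          ← ENNReal.tsum_mul_left]
        exact tsum_congr fun n => by split_ifs <;> simp
      · rw [Set.indicator_of_notMem (fun h => hst h.2), erlangCDF,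
          if_neg (by simpa using hst), mul_zero]
    · rw [Set.indicator_of_notMem (fun h => hs h.1), exponentialPDF_of_neg (not_le.1 hs), zero_mul]
  simp_rw [hpt]
  rw [lintegral_indicator measurableSet_Icc, erlangCDF]
  split_ifs with ht
  -- Convolution with the exponential density raises the Poisson index by one; the index `0` term on
  -- the right is absent since `k + 1 > 0`.
  · rw [lintegral_tsum fun n => ?_,
      tsum_eq_zero_add' (f := fun n => if k + 1 ≤ n then poissonWeight Q t n else 0)
        ENNReal.summable]
    · rw [if_neg (by omega), zero_add]
      refine tsum_congr fun n => ?_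
      simp only [Nat.add_le_add_iff_right]
      split_ifs
      · exact setLIntegral_poissonWeight hQ ht n
      · simp
    · split_ifs
      · exact ((by fun_prop : Measurable fun s : ℝ =>
          ENNReal.ofReal (Q * Real.exp (-(Q * s)))).mul ((measurable_poissonWeight Q n).comp
            (measurable_const.sub measurable_id))).aemeasurable
      · exact aemeasurable_const
  · rw [Set.Icc_eq_empty ht]
    simp

theorem dependsOn_birthTime (u : List ℕ) :
    DependsOn (fun x : List ℕ → ℝ => birthTime x u) {v | v.length < u.length} := by
  induction u with
  | nil => exact fun _ _ _ => rfl
  | cons i u ih =>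
    intro x y h
    have h₁ : birthTime x u = birthTime y u := ih fun v hv => h v (by
      simp only [Set.mem_ofPred_eq, List.length_cons] at hv ⊢; omega)
    have h₂ : x u = y u := h u (by simp)
    simp [birthTime, h₁, h₂]

namespace IsRandomTree

variable {Ω : Type*} [MeasurableSpace Ω] {P : Measure Ω} {Q : ℝ} {f : PMF ℕ}
  {τ : List ℕ → Ω → ℝ} {ν : List ℕ → Ω → ℕ}

theorem measurable_birthTime (h : IsRandomTree P Q f τ ν) (u : List ℕ) :
    Measurable fun ω => birthTime (fun v => τ v ω) u :=
  (RandomTree.measurable_birthTime u).comp (measurable_pi_lambda _ h.measurable_lifetime)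

theorem measure_birthTime_le (h : IsRandomTree P Q f τ ν) [IsProbabilityMeasure P] (hQ : 0 < Q)
    (u : List ℕ) (t : ℝ) :
    P {ω | birthTime (fun v => τ v ω) u ≤ t} = erlangCDF Q u.length t := by
  induction u generalizing t with
  | nil =>
    rw [List.length_nil, erlangCDF_zero hQ]
    split_ifs with ht <;> simp [birthTime, ht]
  | cons i u ih =>
    have hind : IndepFun (fun ω => birthTime (fun v => τ v ω) u) (τ u) P :=
      indepFun_of_dependsOn h.measurable_lifetime h.indep_lifetime
        (S := {v | v.length < u.length}) (T := {u}) (by simp)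
        (g := fun x => birthTime x u) (g' := fun x => x u) (RandomTree.measurable_birthTime u)
        (measurable_pi_apply u) (dependsOn_birthTime u) (dependsOn_apply u)
    have hb := h.measurable_birthTime u
    have hτ := h.measurable_lifetime u
    have hset : MeasurableSet {z : ℝ × ℝ | z.1 + z.2 ≤ t} :=
      measurableSet_le (measurable_fst.add measurable_snd) measurable_const
    have := isProbabilityMeasure_expMeasure hQ
    have := Measure.isProbabilityMeasure_map (μ := P) hb.aemeasurable
    have hprod := (indepFun_iff_map_prod_eq_prod_map_map hb.aemeasurable hτ.aemeasurable).1 hind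
    have hmap : P {ω | birthTime (fun v => τ v ω) (i :: u) ≤ t} =
        (P.map fun ω => (birthTime (fun v => τ v ω) u, τ u ω)) {z | z.1 + z.2 ≤ t} := by
      rw [Measure.map_apply (hb.prodMk hτ) hset]
      rfl
    rw [hmap, hprod, h.map_lifetime, Measure.prod_apply_symm hset, List.length_cons,
      ← lintegral_erlangCDF_sub hQ]
    refine lintegral_congr fun s => ?_
    rw [← ih, Measure.map_apply hb (measurable_prodMk_right hset)]
    congr 1
    ext ω
    simp [le_sub_iff_add_le]

/-- Existence and birth time of a node are independent, so each label contributes a product; summing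
over labels and then exchanging generation and Poisson index gives a Poisson average of geometric
sums. -/
theorem lintegral_treeSize (h : IsRandomTree P Q f τ ν) [IsProbabilityMeasure P] (hQ : 0 < Q)
    {t : ℝ} (ht : 0 ≤ t) :
    ∫⁻ ω, (treeSize (fun u => τ u ω) (fun u => ν u ω) t : ℝ≥0∞) ∂P =
      ∑' n, poissonWeight Q t n * ∑ k ∈ Finset.range (n + 1), factorialMoment f 1 ^ k := by
  have hpresent (u : List ℕ) :
      P {ω | IsNode (fun v => ν v ω) u ∧ birthTime (fun v => τ v ω) u ≤ t} =
        nodeWeight f u * erlangCDF Q u.length t := by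
    rw [← h.isOffspringFamily.measure_isNode u, ← h.measure_birthTime_le hQ u t, mul_comm]
    have hset : {ω | IsNode (fun v => ν v ω) u ∧ birthTime (fun v => τ v ω) u ≤ t} =
        {ω | birthTime (fun v => τ v ω) u ≤ t} ∩ {ω | IsNode (fun v => ν v ω) u} := by
      ext ω
      exact and_comm
    rw [hset]
    exact h.indep_lifetime_offspring.measure_inter_preimage_eq_mul {x | birthTime x u ≤ t}
      {x | IsNode x u} (RandomTree.measurable_birthTime u measurableSet_Iic)
      (measurableSet_isNode u)
  simp only [treeSize]
  rw [lintegral_encard P (s := fun ω => {u : List ℕ | IsNode (fun v => ν v ω) u ∧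
    birthTime (fun v => τ v ω) u ≤ t}) (h.measurableSet_present t)]
  simp only [Set.mem_ofPred_eq, hpresent]
  rw [tsum_nodeWeight_mul f fun k => erlangCDF Q k t]
  simp only [erlangCDF, if_pos ht]
  simp_rw [← ENNReal.tsum_mul_left]
  rw [ENNReal.tsum_comm]
  refine tsum_congr fun n => ?_
  rw [tsum_eq_sum (s := Finset.range (n + 1)), Finset.mul_sum]
  · refine Finset.sum_congr rfl fun k hk => ?_
    rw [if_pos (Nat.lt_succ_iff.1 (Finset.mem_range.1 hk)), mul_comm]
  · intro k hk
    rw [if_neg (by simpa using hk), mul_zero]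

theorem lintegral_treeSize_eq_ofReal (h : IsRandomTree P Q f τ ν) [IsProbabilityMeasure P]
    (hQ : 0 < Q) (hq₁ : factorialMoment f 1 ≠ ∞) {t S : ℝ} (ht : 0 ≤ t)
    (hS : HasSum (fun n : ℕ => Real.exp (-(Q * t)) * ((Q * t) ^ n / n.factorial) *
      ∑ k ∈ Finset.range (n + 1), meanOffspring f ^ k) S) :
    ∫⁻ ω, (treeSize (fun u => τ u ω) (fun u => ν u ω) t : ℝ≥0∞) ∂P = ENNReal.ofReal S := by
  have hm : 0 ≤ meanOffspring f := ENNReal.toReal_nonneg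
  have hq : factorialMoment f 1 = ENNReal.ofReal (meanOffspring f) :=
    (ENNReal.ofReal_toReal hq₁).symm
  rw [h.lintegral_treeSize hQ ht, ← hS.tsum_eq,
    ENNReal.ofReal_tsum_of_nonneg (fun n => by positivity) hS.summable]
  refine tsum_congr fun n => ?_
  rw [ENNReal.ofReal_mul (by positivity), ENNReal.ofReal_sum_of_nonneg fun k _ => by positivity,
    poissonWeight, hq]
  simp_rw [ENNReal.ofReal_pow hm]

end IsRandomTree

/-! ### Explicit means and the supercritical and critical limits -/

theorem hasSum_poisson_mul_geom (x : ℝ) {m : ℝ} (hm : m ≠ 1) :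
    HasSum (fun n : ℕ => Real.exp (-x) * (x ^ n / n.factorial) *
      ∑ k ∈ Finset.range (n + 1), m ^ k) ((m * Real.exp ((m - 1) * x) - 1) / (m - 1)) := by
  have h := (((hasSum_exp (m * x)).mul_left m).sub (hasSum_exp x)).mul_left
    (Real.exp (-x) / (m - 1))
  convert! h using 1
  · funext n
    rw [geom_sum_eq hm, mul_pow]
    ring
  · rw [show (m - 1) * x = -x + m * x by ring, Real.exp_add]
    have : Real.exp (-x) * Real.exp x = 1 := by rw [← Real.exp_add]; simp
    linear_combination (1 / (m - 1)) * this

theorem hasSum_poisson_mul_succ (x : ℝ) :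
    HasSum (fun n : ℕ => Real.exp (-x) * (x ^ n / n.factorial) *
      ∑ k ∈ Finset.range (n + 1), (1 : ℝ) ^ k) (x + 1) := by
  have h₁ : HasSum (fun n : ℕ => (n : ℝ) * (x ^ n / n.factorial)) (x * Real.exp x) := by
    rw [← hasSum_nat_add_iff' 1]
    convert! (hasSum_exp x).mul_left x using 1
    · funext n
      rw [Nat.factorial_succ]
      push_cast
      field_simp
      ring
    · simp
  convert! (h₁.add (hasSum_exp x)).mul_left (Real.exp (-x)) using 1
  · funext n
    simp
    ring
  · have : Real.exp (-x) * Real.exp x = 1 := by rw [← Real.exp_add]; simp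
    linear_combination -(x + 1) * this

namespace IsRandomTree

variable {Ω : Type*} [MeasurableSpace Ω] {P : Measure Ω} [IsProbabilityMeasure P] {Q : ℝ}
  {f : PMF ℕ} {τ : List ℕ → Ω → ℝ} {ν : List ℕ → Ω → ℕ}

theorem supercritical (h : IsRandomTree P Q f τ ν) (hQ : 0 < Q)
    (hq₁ : factorialMoment f 1 ≠ ∞) (hm : 1 < meanOffspring f) :
    Tendsto
      (fun t : ℝ => ∫⁻ ω, (treeSize (fun u => τ u ω) (fun u => ν u ω) t : ℝ≥0∞) *
        ENNReal.ofReal (Real.exp (-(meanOffspring f - 1) * Q * t)) ∂P)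
      atTop (𝓝 (ENNReal.ofReal (meanOffspring f / (meanOffspring f - 1)))) := by
  set m := meanOffspring f
  have hlim : Tendsto (fun t : ℝ => ENNReal.ofReal
      ((m - Real.exp (-(m - 1) * Q * t)) / (m - 1))) atTop
      (𝓝 (ENNReal.ofReal (m / (m - 1)))) := by
    refine ENNReal.tendsto_ofReal ?_
    have hexp : Tendsto (fun t : ℝ => Real.exp (-(m - 1) * Q * t)) atTop (𝓝 0) :=
      Real.tendsto_exp_atBot.comp
        (tendsto_id.const_mul_atTop_of_neg (by nlinarith [mul_pos (sub_pos.2 hm) hQ]))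
    simpa using (tendsto_const_nhds.sub hexp).div_const (m - 1)
  refine hlim.congr' ?_
  filter_upwards [eventually_ge_atTop 0] with t ht
  rw [lintegral_mul_const _ (h.measurable_treeSize t),
    h.lintegral_treeSize_eq_ofReal hQ hq₁ ht (hasSum_poisson_mul_geom (Q * t) hm.ne'),
    ← ENNReal.ofReal_mul' (Real.exp_nonneg _)]
  congr 1
  have : Real.exp ((m - 1) * (Q * t)) * Real.exp (-(m - 1) * Q * t) = 1 := by
    rw [← Real.exp_add, ← Real.exp_zero]
    congr 1
    ring
  linear_combination -(m / (m - 1)) * this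

theorem critical (h : IsRandomTree P Q f τ ν) (hQ : 0 < Q)
    (hq₁ : factorialMoment f 1 ≠ ∞) (hm : meanOffspring f = 1) :
    Tendsto
      (fun t : ℝ => ∫⁻ ω, (treeSize (fun u => τ u ω) (fun u => ν u ω) t : ℝ≥0∞) /
        ENNReal.ofReal (Q * t) ∂P)
      atTop (𝓝 1) := by
  have hlim : Tendsto (fun t : ℝ => ENNReal.ofReal (1 + (Q * t)⁻¹)) atTop (𝓝 1) := by
    rw [← ENNReal.ofReal_one]
    refine ENNReal.tendsto_ofReal ?_
    simpa using (tendsto_inv_atTop_zero.comp (tendsto_id.const_mul_atTop hQ)).const_add (1 : ℝ)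
  refine hlim.congr' ?_
  filter_upwards [eventually_gt_atTop 0] with t ht
  have hQt : 0 < Q * t := mul_pos hQ ht
  have hS := hasSum_poisson_mul_succ (Q * t)
  -- Only the base of the geometric sum becomes `meanOffspring f`; the `1` in the value `Q * t + 1`
  -- stays.
  nth_rewrite 1 [← hm] at hS
  simp_rw [div_eq_mul_inv]
  rw [lintegral_mul_const _ (h.measurable_treeSize t),
    h.lintegral_treeSize_eq_ofReal hQ hq₁ ht.le hS,
    ← div_eq_mul_inv, ← ENNReal.ofReal_div_of_pos hQt]
  congr 1
  field_simp

end IsRandomTree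

end RandomTree

theorem mainTheorem5 {Ω : Type*} [MeasurableSpace Ω] (P : Measure Ω) [IsProbabilityMeasure P]
    (Q : ℝ) (hQ : 0 < Q) (f : PMF ℕ)
    (hq₁ : RandomTree.factorialMoment f 1 ≠ ∞) (hq₂ : RandomTree.factorialMoment f 2 ≠ ∞)
    (τ : List ℕ → Ω → ℝ) (ν : List ℕ → Ω → ℕ)
    (hT : RandomTree.IsRandomTree P Q f τ ν) :
    -- subcritical case
    (RandomTree.meanOffspring f < 1 →
      (∃! p : PMF ℕ, RandomTree.IsStationaryLaw P τ ν p) ∧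
      ∀ p : PMF ℕ, RandomTree.IsStationaryLaw P τ ν p →
        MemLp (fun n : ℕ => (n : ℝ)) 2 p.toMeasure ∧
        ∫ n : ℕ, (n : ℝ) ∂p.toMeasure = 1 / (1 - RandomTree.meanOffspring f) ∧
        RandomTree.stdDev p =
          RandomTree.stdDev f / (1 - RandomTree.meanOffspring f) ^ (3 / 2 : ℝ)) ∧
    -- supercritical case
    (1 < RandomTree.meanOffspring f →
      Tendsto
        (fun t : ℝ => ∫⁻ ω, (RandomTree.treeSize (fun u => τ u ω) (fun u => ν u ω) t : ℝ≥0∞) *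
          ENNReal.ofReal (Real.exp (-(RandomTree.meanOffspring f - 1) * Q * t)) ∂P)
        atTop
        (𝓝 (ENNReal.ofReal (RandomTree.meanOffspring f / (RandomTree.meanOffspring f - 1))))) ∧
    -- critical case
    (RandomTree.meanOffspring f = 1 →
      Tendsto
        (fun t : ℝ => ∫⁻ ω, (RandomTree.treeSize (fun u => τ u ω) (fun u => ν u ω) t : ℝ≥0∞) /
          ENNReal.ofReal (Q * t) ∂P)
        atTop (𝓝 1)) := by
  refine ⟨fun hm => ?_, hT.supercritical hQ hq₁, hT.critical hQ hq₁⟩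
  refine hT.subcritical ?_ hq₂
  rw [RandomTree.meanOffspring, ← ENNReal.toReal_one,
    ENNReal.toReal_lt_toReal hq₁ ENNReal.one_ne_top] at hm
  exact hm
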